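/- Let $(M,g)$ be a smooth (Hausdorff) Riemannian manifold of dimension $n>2$ with Levi-Civita connection $\nabla$, let $\xi$ be a smooth vector field with $g(\xi,\xi)=1$, and let $\pi$ be the $1$-form $\pi(X)=g(X,\xi)$. Assume that $\pi$ is parallel, i.e. $(\nabla_X\pi)(Y)=X(\pi(Y))-\pi(\nabla_XY)=0$ for all vector fields $X,Y$. Let $\tilde\nabla$ be the projective semi-symmetric connection $$\tilde\nabla_XY=\nabla_XY+\psi(Y)X+\psi(X)Y+\phi(Y)X-\phi(X)Y,\qquad \phi=\tfrac12\,\pi,\quad \psi=\tfrac{n-1}{2(n+1)}\,\pi,$$ and let $\tilde R(X,Y)Z=\tilde\nabla_X\tilde\nabla_YZ-\tilde\nabla_Y\tilde\nabla_XZ-\tilde\nabla_{[X,Y]}Z$ be its curvature tensor. Suppose that $(M,g)$ is semi-symmetric with respect to $\tilde\nabla$, i.e. $\tilde R\cdot\tilde R=0$, which means $$\tilde R(X,Y)\tilde R(Z,U)V-\tilde R(\tilde R(X,Y)Z,U)V-\tilde R(Z,\tilde R(X,Y)U)V-\tilde R(Z,U)\tilde R(X,Y)V=0$$ for all vector fields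 $X,Y,Z,U,V$. Then $\tilde R$ is recurrent with respect to $\tilde\nabla$, in the sense that for all vector fields $X,Y,Z,U$, $$(\tilde\nabla_X\tilde R)(Y,Z)U=\rho(X)\,\tilde R(Y,Z)U,\qquad \rho=-\frac{2(n-1)}{n+1}\,\pi,$$ where $(\tilde\nabla_X\tilde R)(Y,Z)U=\tilde\nabla_X(\tilde R(Y,Z)U)-\tilde R(\tilde\nabla_XY,Z)U-\tilde R(Y,\tilde\nabla_XZ)U-\tilde R(Y,Z)\tilde\nabla_XU$. -/

import Mathlib

open Bundle
open scoped Manifold ContDiff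

noncomputable section

namespace ProjSemiSymm

variable {E : Type*} [NormedAddCommGroup E] [NormedSpace ℝ E]
  {M : Type*} [TopologicalSpace M] [ChartedSpace E M] [IsManifold 𝓘(ℝ, E) ∞ M]

/-- A smooth (`C^∞`) vector field on `M`. -/
def IsSmoothField (X : (x : M) → TangentSpace 𝓘(ℝ, E) x) : Prop :=
  ContMDiff 𝓘(ℝ, E) 𝓘(ℝ, E).tangent ∞ (fun x : M => (⟨x, X x⟩ : TangentBundle 𝓘(ℝ, E) M))

/-- The vector field `∇_X Y` of a linear connection `∇`. -/
def nabla (D : CovariantDerivative 𝓘(ℝ, E) E (TangentSpace 𝓘(ℝ, E) : M → Type _))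
    (X Y : (x : M) → TangentSpace 𝓘(ℝ, E) x) : (x : M) → TangentSpace 𝓘(ℝ, E) x :=
  fun x => D Y x (X x)

/-- The curvature tensor of a linear connection,
`R(X, Y) Z = ∇_X ∇_Y Z - ∇_Y ∇_X Z - ∇_[X, Y] Z`. -/
def curvature (D : CovariantDerivative 𝓘(ℝ, E) E (TangentSpace 𝓘(ℝ, E) : M → Type _))
    (X Y Z : (x : M) → TangentSpace 𝓘(ℝ, E) x) : (x : M) → TangentSpace 𝓘(ℝ, E) x :=
  nabla D X (nabla D Y Z) - nabla D Y (nabla D X Z)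
    - nabla D (VectorField.mlieBracket 𝓘(ℝ, E) X Y) Z

/-- The action of the curvature endomorphism `R(X, Y)`, as a derivation, on the curvature tensor:
`(R(X, Y) · R)(Z, U) V =
  R(X, Y) R(Z, U) V - R(R(X, Y) Z, U) V - R(Z, R(X, Y) U) V - R(Z, U) R(X, Y) V`. -/
def curvatureActCurvature
    (D : CovariantDerivative 𝓘(ℝ, E) E (TangentSpace 𝓘(ℝ, E) : M → Type _))
    (X Y Z U V : (x : M) → TangentSpace 𝓘(ℝ, E) x) : (x : M) → TangentSpace 𝓘(ℝ, E) x :=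
  curvature D X Y (curvature D Z U V) - curvature D (curvature D X Y Z) U V
    - curvature D Z (curvature D X Y U) V - curvature D Z U (curvature D X Y V)

/-- `M` is semi-symmetric with respect to the linear connection `D`: `R · R = 0` for the
curvature tensor `R` of `D`. -/
def IsSemiSymmetricFor
    (D : CovariantDerivative 𝓘(ℝ, E) E (TangentSpace 𝓘(ℝ, E) : M → Type _)) : Prop :=
  ∀ X Y Z U V : (x : M) → TangentSpace 𝓘(ℝ, E) x,
    IsSmoothField X → IsSmoothField Y → IsSmoothField Z → IsSmoothField U → IsSmoothField V →
    curvatureActCurvature D X Y Z U V = 0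

/-- The covariant derivative of the curvature tensor of `D` with respect to `D` itself:
`(∇_X R)(Y, Z) U = ∇_X (R(Y, Z) U) - R(∇_X Y, Z) U - R(Y, ∇_X Z) U - R(Y, Z) ∇_X U`. -/
def nablaCurvature (D : CovariantDerivative 𝓘(ℝ, E) E (TangentSpace 𝓘(ℝ, E) : M → Type _))
    (X Y Z U : (x : M) → TangentSpace 𝓘(ℝ, E) x) : (x : M) → TangentSpace 𝓘(ℝ, E) x :=
  nabla D X (curvature D Y Z U) - curvature D (nabla D X Y) Z U
    - curvature D Y (nabla D X Z) U - curvature D Y Z (nabla D X U)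

/-- The curvature tensor of `D` is recurrent with recurrence `1`-form `ρ`:
`(∇_X R)(Y, Z) U = ρ(X) R(Y, Z) U`. -/
def IsRecurrentWith (D : CovariantDerivative 𝓘(ℝ, E) E (TangentSpace 𝓘(ℝ, E) : M → Type _))
    (ρ : (x : M) → TangentSpace 𝓘(ℝ, E) x →L[ℝ] ℝ) : Prop :=
  ∀ X Y Z U : (x : M) → TangentSpace 𝓘(ℝ, E) x,
    IsSmoothField X → IsSmoothField Y → IsSmoothField Z → IsSmoothField U →
    ∀ x : M, nablaCurvature D X Y Z U x = ρ x (X x) • curvature D Y Z U x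

/-- The covariant derivative of the `1`-form `η` vanishes:
`(∇_X η)(Y) = X(η(Y)) - η(∇_X Y) = 0` for all smooth vector fields `X`, `Y`. -/
def IsParallelOneForm
    (D : CovariantDerivative 𝓘(ℝ, E) E (TangentSpace 𝓘(ℝ, E) : M → Type _))
    (η : (x : M) → TangentSpace 𝓘(ℝ, E) x →L[ℝ] ℝ) : Prop :=
  ∀ X Y : (x : M) → TangentSpace 𝓘(ℝ, E) x, IsSmoothField X → IsSmoothField Y →
    ∀ x : M, mvfderiv 𝓘(ℝ, E) (fun y => η y (Y y)) x (X x) - η x (nabla D X Y x) = 0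

/-- For a linear connection `∇` and a `1`-form `η` on an `n`-dimensional manifold, the connection
`∇~_X Y = ∇_X Y + ψ(Y) X + ψ(X) Y + φ(Y) X - φ(X) Y`,
where `φ = (1/2) η` and `ψ = (n - 1) / (2 (n + 1)) η`. -/
def projSemiSymmConnection
    (D : CovariantDerivative 𝓘(ℝ, E) E (TangentSpace 𝓘(ℝ, E) : M → Type _))
    (η : (x : M) → TangentSpace 𝓘(ℝ, E) x →L[ℝ] ℝ) :
    CovariantDerivative 𝓘(ℝ, E) E (TangentSpace 𝓘(ℝ, E) : M → Type _) :=
  let n : ℝ := Module.finrank ℝ E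
  let φ : (x : M) → TangentSpace 𝓘(ℝ, E) x →L[ℝ] ℝ := fun x => (1 / 2 : ℝ) • η x
  let ψ : (x : M) → TangentSpace 𝓘(ℝ, E) x →L[ℝ] ℝ := fun x => ((n - 1) / (2 * (n + 1))) • η x
  { toFun := fun Y x => D Y x
      + ψ x (Y x) • ContinuousLinearMap.id ℝ (TangentSpace 𝓘(ℝ, E) x)
      + (ψ x).smulRight (Y x)
      + φ x (Y x) • ContinuousLinearMap.id ℝ (TangentSpace 𝓘(ℝ, E) x)
      - (φ x).smulRight (Y x)
    isCovariantDerivativeOnUniv :=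
      { add := by
          intro σ σ' x hσ hσ' _
          ext v
          simp [D.isCovariantDerivativeOnUniv.add hσ hσ']
          module
        leibniz := by
          intro σ g x hσ hg _
          ext v
          simp [D.isCovariantDerivativeOnUniv.leibniz hσ hg]
          module } }

theorem nabla_projSemiSymmConnection
    (D : CovariantDerivative 𝓘(ℝ, E) E (TangentSpace 𝓘(ℝ, E) : M → Type _))
    (η : (x : M) → TangentSpace 𝓘(ℝ, E) x →L[ℝ] ℝ)
    (X Y : (x : M) → TangentSpace 𝓘(ℝ, E) x) (x : M) :
    nabla (projSemiSymmConnection D η) X Y x = nabla D X Y x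
      + (((Module.finrank ℝ E : ℝ) - 1) / (2 * ((Module.finrank ℝ E : ℝ) + 1)) * η x (Y x)) • X x
      + (((Module.finrank ℝ E : ℝ) - 1) / (2 * ((Module.finrank ℝ E : ℝ) + 1)) * η x (X x)) • Y x
      + (1 / 2 * η x (Y x)) • X x - (1 / 2 * η x (X x)) • Y x := by
  rfl

/-- The `1`-form `η(X) = g(X, ξ)` metrically dual to the vector field `ξ`. -/
def dualForm
    (g : ContMDiffRiemannianMetric 𝓘(ℝ, E) ∞ E (TangentSpace 𝓘(ℝ, E) : M → Type _))
    (ξ : (x : M) → TangentSpace 𝓘(ℝ, E) x) : (x : M) → TangentSpace 𝓘(ℝ, E) x →L[ℝ] ℝ :=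
  fun x => g.inner x (ξ x)

/-- `D` is the Levi-Civita connection of the Riemannian metric `g`: it is a smooth connection (it
sends smooth fields to smooth fields), it is torsion-free, and it is compatible with the metric,
`X(g(Y, Z)) = g(∇_X Y, Z) + g(Y, ∇_X Z)`. -/
structure IsLeviCivita [FiniteDimensional ℝ E]
    (g : ContMDiffRiemannianMetric 𝓘(ℝ, E) ∞ E (TangentSpace 𝓘(ℝ, E) : M → Type _))
    (D : CovariantDerivative 𝓘(ℝ, E) E (TangentSpace 𝓘(ℝ, E) : M → Type _)) : Prop where
  smooth : CovariantDerivative.ContMDiffCovariantDerivative D ∞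
  torsion_free : D.torsion = 0
  metric : ∀ X Y Z : (x : M) → TangentSpace 𝓘(ℝ, E) x,
    IsSmoothField X → IsSmoothField Y → IsSmoothField Z → ∀ x : M,
    mvfderiv 𝓘(ℝ, E) (fun y => g.inner y (Y y) (Z y)) x (X x)
      = g.inner x (nabla D X Y x) (Z x) + g.inner x (Y x) (nabla D X Z x)

end ProjSemiSymm

end

/-!
Write `∇'_X Y = ∇_X Y + c η(Y) X + d η(X) Y` with `η` parallel and `∇` torsion-free. Then
`R'(X, Y) Z = R(X, Y) Z + c² η(Z) (η(Y) X - η(X) Y)`. If `ξ` is parallel and `η(ξ) = 1`, then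
`R(X, Y) ξ = 0` and `η ∘ R = 0`, whence `(R'(ξ, Z) · R')(X, Y) ξ = c² R(X, Y) Z`: semi-symmetry for
`∇'` with `c ≠ 0` forces `∇` to be flat. The remaining part of `R'` is built from `η` and the
identity, and `∇' η = -(c + d) η ⊗ η`, so its two factors of `η` yield the recurrence form
`-2 (c + d) η`.
-/

namespace ProjSemiSymm

open VectorField

variable {E : Type*} [NormedAddCommGroup E] [NormedSpace ℝ E]
  {M : Type*} [TopologicalSpace M] [ChartedSpace E M]
  {X Y Z ξ : (x : M) → TangentSpace 𝓘(ℝ, E) x} {f : M → ℝ}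
  {η : (x : M) → TangentSpace 𝓘(ℝ, E) x →L[ℝ] ℝ} {c d : ℝ}

section Pairing

/-- The function `η(X)` obtained by applying a `1`-form to a vector field. -/
noncomputable def pairing (η : (x : M) → TangentSpace 𝓘(ℝ, E) x →L[ℝ] ℝ)
    (X : (x : M) → TangentSpace 𝓘(ℝ, E) x) : M → ℝ :=
  fun x ↦ η x (X x)

lemma pairing_add (X Y : (x : M) → TangentSpace 𝓘(ℝ, E) x) :
    pairing η (X + Y) = pairing η X + pairing η Y :=
  funext fun x ↦ map_add (η x) (X x) (Y x)

lemma pairing_sub (X Y : (x : M) → TangentSpace 𝓘(ℝ, E) x) :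
    pairing η (X - Y) = pairing η X - pairing η Y :=
  funext fun x ↦ map_sub (η x) (X x) (Y x)

lemma pairing_smul (f : M → ℝ) (X : (x : M) → TangentSpace 𝓘(ℝ, E) x) :
    pairing η (f • X) = f * pairing η X :=
  funext fun x ↦ map_smul (η x) (f x) (X x)

lemma pairing_const_smul (a : ℝ) (X : (x : M) → TangentSpace 𝓘(ℝ, E) x) :
    pairing η (a • X) = a • pairing η X :=
  funext fun x ↦ map_smul (η x) a (X x)

end Pairing

variable [IsManifold 𝓘(ℝ, E) ∞ M]
  {D : CovariantDerivative 𝓘(ℝ, E) E (TangentSpace 𝓘(ℝ, E) : M → Type _)}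

section SmoothFields

lemma IsSmoothField.add (hX : IsSmoothField X) (hY : IsSmoothField Y) : IsSmoothField (X + Y) :=
  ContMDiff.add_section hX hY

lemma IsSmoothField.sub (hX : IsSmoothField X) (hY : IsSmoothField Y) : IsSmoothField (X - Y) :=
  ContMDiff.sub_section hX hY

lemma IsSmoothField.smul (hf : ContMDiff 𝓘(ℝ, E) 𝓘(ℝ, ℝ) ∞ f) (hX : IsSmoothField X) :
    IsSmoothField (f • X) :=
  ContMDiff.smul_section hf hX

lemma IsSmoothField.const_smul (a : ℝ) (hX : IsSmoothField X) : IsSmoothField (a • X) :=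
  ContMDiff.const_smul_section hX

lemma IsSmoothField.mdifferentiableAt (hX : IsSmoothField X) (x : M) :
    MDifferentiableAt 𝓘(ℝ, E) 𝓘(ℝ, E).tangent
      (fun y : M ↦ (⟨y, X y⟩ : TangentBundle 𝓘(ℝ, E) M)) x :=
  ContMDiff.mdifferentiableAt hX (by simp)

lemma IsSmoothField.mlieBracket [CompleteSpace E] (hX : IsSmoothField X) (hY : IsSmoothField Y) :
    IsSmoothField (mlieBracket 𝓘(ℝ, E) X Y) := by
  have : IsManifold 𝓘(ℝ, E) (minSmoothness ℝ 2) M := by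
    rw [minSmoothness_of_isRCLikeNormedField]
    infer_instance
  have : IsManifold 𝓘(ℝ, E) ((⊤ : ℕ∞) + 1) M := ‹IsManifold 𝓘(ℝ, E) ∞ M›
  exact fun x ↦ ContMDiffAt.mlieBracket_vectorField (m := ⊤) (n := ⊤) (hX x) (hY x) (by simp)

/-- The derivative `X(f)` of a function along a vector field. -/
noncomputable def directionalDeriv (X : (x : M) → TangentSpace 𝓘(ℝ, E) x) (f : M → ℝ) : M → ℝ :=
  fun x ↦ mvfderiv 𝓘(ℝ, E) f x (X x)

lemma IsSmoothField.contMDiff_directionalDeriv (hX : IsSmoothField X)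
    (hf : ContMDiff 𝓘(ℝ, E) 𝓘(ℝ, ℝ) ∞ f) :
    ContMDiff 𝓘(ℝ, E) 𝓘(ℝ, ℝ) ∞ (directionalDeriv X f) :=
  (contMDiff_snd_tangentBundle_modelSpace ℝ 𝓘(ℝ, ℝ)).comp
    ((hf.contMDiff_tangentMap (m := ∞) (by simp)).comp hX)

end SmoothFields

section LieBracket

variable [CompleteSpace E]

lemma mlieBracket_add_field (X : (x : M) → TangentSpace 𝓘(ℝ, E) x)
    (hY : IsSmoothField Y) (hZ : IsSmoothField Z) :
    mlieBracket 𝓘(ℝ, E) X (Y + Z) = mlieBracket 𝓘(ℝ, E) X Y + mlieBracket 𝓘(ℝ, E) X Z :=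
  funext fun x ↦ mlieBracket_add_right (hY.mdifferentiableAt x) (hZ.mdifferentiableAt x)

lemma mlieBracket_smul_field (X : (x : M) → TangentSpace 𝓘(ℝ, E) x)
    (hf : ContMDiff 𝓘(ℝ, E) 𝓘(ℝ, ℝ) ∞ f) (hY : IsSmoothField Y) :
    mlieBracket 𝓘(ℝ, E) X (f • Y) = directionalDeriv X f • Y + f • mlieBracket 𝓘(ℝ, E) X Y :=
  funext fun x ↦
    mlieBracket_smul_right (hf.mdifferentiableAt (by simp)) (hY.mdifferentiableAt x)

lemma mlieBracket_mlieBracket (hX : IsSmoothField X) (hY : IsSmoothField Y)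
    (hZ : IsSmoothField Z) :
    mlieBracket 𝓘(ℝ, E) X (mlieBracket 𝓘(ℝ, E) Y Z) =
      mlieBracket 𝓘(ℝ, E) (mlieBracket 𝓘(ℝ, E) X Y) Z
        + mlieBracket 𝓘(ℝ, E) Y (mlieBracket 𝓘(ℝ, E) X Z) := by
  have : IsManifold 𝓘(ℝ, E) (minSmoothness ℝ 3) M := by
    rw [minSmoothness_of_isRCLikeNormedField]
    infer_instance
  apply leibniz_identity_mlieBracket <;> rw [minSmoothness_of_isRCLikeNormedField]
  exacts [ContMDiff.of_le hX (by norm_cast), ContMDiff.of_le hY (by norm_cast),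
    ContMDiff.of_le hZ (by norm_cast)]

-- Compare the Jacobi identities for `X, Y, Z` and for `X, Y, f • Z`.
lemma directionalDeriv_mlieBracket_smul (hX : IsSmoothField X) (hY : IsSmoothField Y)
    (hZ : IsSmoothField Z) (hf : ContMDiff 𝓘(ℝ, E) 𝓘(ℝ, ℝ) ∞ f) :
    directionalDeriv (mlieBracket 𝓘(ℝ, E) X Y) f • Z =
      (directionalDeriv X (directionalDeriv Y f) - directionalDeriv Y (directionalDeriv X f))
        • Z := by
  have hXf := hX.contMDiff_directionalDeriv hf
  have hYf := hY.contMDiff_directionalDeriv hf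
  have hXZ := hX.mlieBracket hZ
  have hYZ := hY.mlieBracket hZ
  have jacobi := mlieBracket_mlieBracket hX hY (hZ.smul hf)
  rw [mlieBracket_smul_field Y hf hZ, mlieBracket_smul_field X hf hZ,
    mlieBracket_smul_field _ hf hZ,
    mlieBracket_add_field X (hZ.smul hYf) (hYZ.smul hf),
    mlieBracket_add_field Y (hZ.smul hXf) (hXZ.smul hf),
    mlieBracket_smul_field X hYf hZ, mlieBracket_smul_field X hf hYZ,
    mlieBracket_smul_field Y hXf hZ, mlieBracket_smul_field Y hf hXZ,
    mlieBracket_mlieBracket hX hY hZ] at jacobi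
  rw [← sub_eq_zero] at jacobi ⊢
  rw [← neg_eq_zero, ← jacobi]
  module

end LieBracket

section Connection

/-- A linear connection is smooth if it maps smooth vector fields to smooth vector fields. -/
def IsSmoothConnection
    (D : CovariantDerivative 𝓘(ℝ, E) E (TangentSpace 𝓘(ℝ, E) : M → Type _)) : Prop :=
  ∀ X Y : (x : M) → TangentSpace 𝓘(ℝ, E) x, IsSmoothField X → IsSmoothField Y →
    IsSmoothField (nabla D X Y)

/-- A linear connection is torsion-free if `[X, Y] = ∇_X Y - ∇_Y X`. The condition is imposed on
smooth fields, instead of on Mathlib's torsion tensor, so as to make sense on Banach manifolds. -/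
def IsTorsionFree
    (D : CovariantDerivative 𝓘(ℝ, E) E (TangentSpace 𝓘(ℝ, E) : M → Type _)) : Prop :=
  ∀ X Y : (x : M) → TangentSpace 𝓘(ℝ, E) x, IsSmoothField X → IsSmoothField Y →
    mlieBracket 𝓘(ℝ, E) X Y = nabla D X Y - nabla D Y X

/-- A linear connection is flat if its curvature tensor vanishes on smooth vector fields. -/
def IsFlat (D : CovariantDerivative 𝓘(ℝ, E) E (TangentSpace 𝓘(ℝ, E) : M → Type _)) : Prop :=
  ∀ X Y Z : (x : M) → TangentSpace 𝓘(ℝ, E) x,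
    IsSmoothField X → IsSmoothField Y → IsSmoothField Z → curvature D X Y Z = 0

/-- The vector field `ξ` is parallel: `∇_X ξ = 0` for all smooth vector fields `X`. -/
def IsParallelField (D : CovariantDerivative 𝓘(ℝ, E) E (TangentSpace 𝓘(ℝ, E) : M → Type _))
    (ξ : (x : M) → TangentSpace 𝓘(ℝ, E) x) : Prop :=
  ∀ X : (x : M) → TangentSpace 𝓘(ℝ, E) x, IsSmoothField X → nabla D X ξ = 0

lemma nabla_add_right (X : (x : M) → TangentSpace 𝓘(ℝ, E) x)
    (hY : IsSmoothField Y) (hZ : IsSmoothField Z) :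
    nabla D X (Y + Z) = nabla D X Y + nabla D X Z := by
  funext x
  simp [nabla, D.isCovariantDerivativeOnUniv.add (hY.mdifferentiableAt x) (hZ.mdifferentiableAt x)]

lemma nabla_sub_right (X : (x : M) → TangentSpace 𝓘(ℝ, E) x)
    (hY : IsSmoothField Y) (hZ : IsSmoothField Z) :
    nabla D X (Y - Z) = nabla D X Y - nabla D X Z := by
  rw [eq_sub_iff_add_eq, ← nabla_add_right X (hY.sub hZ) hZ, sub_add_cancel]

lemma nabla_smul_right (X : (x : M) → TangentSpace 𝓘(ℝ, E) x)
    (hf : ContMDiff 𝓘(ℝ, E) 𝓘(ℝ, ℝ) ∞ f) (hY : IsSmoothField Y) :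
    nabla D X (f • Y) = f • nabla D X Y + directionalDeriv X f • Y := by
  funext x
  simp [nabla, directionalDeriv, D.isCovariantDerivativeOnUniv.leibniz (hY.mdifferentiableAt x)
    (hf.mdifferentiableAt (by simp))]

lemma nabla_const_smul_right (X : (x : M) → TangentSpace 𝓘(ℝ, E) x) (a : ℝ)
    (hY : IsSmoothField Y) : nabla D X (a • Y) = a • nabla D X Y :=
  funext fun x ↦ by
    simp [nabla, D.isCovariantDerivativeOnUniv.smul_const a (hY.mdifferentiableAt x)]

lemma IsSmoothConnection.curvature_sub_right {W : (x : M) → TangentSpace 𝓘(ℝ, E) x}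
    (hD : IsSmoothConnection D) (hX : IsSmoothField X) (hY : IsSmoothField Y)
    (hZ : IsSmoothField Z) (hW : IsSmoothField W) :
    curvature D X Y (Z - W) = curvature D X Y Z - curvature D X Y W := by
  simp only [curvature, nabla_sub_right _ hZ hW,
    nabla_sub_right _ (hD Y Z hY hZ) (hD Y W hY hW),
    nabla_sub_right _ (hD X Z hX hZ) (hD X W hX hW)]
  abel

variable [CompleteSpace E]

lemma IsSmoothConnection.isSmoothField_curvature (hD : IsSmoothConnection D)
    (hX : IsSmoothField X) (hY : IsSmoothField Y) (hZ : IsSmoothField Z) :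
    IsSmoothField (curvature D X Y Z) :=
  ((hD _ _ hX (hD _ _ hY hZ)).sub (hD _ _ hY (hD _ _ hX hZ))).sub
    (hD _ _ (hX.mlieBracket hY) hZ)

lemma IsSmoothConnection.curvature_smul_right (hD : IsSmoothConnection D) (hX : IsSmoothField X)
    (hY : IsSmoothField Y) (hf : ContMDiff 𝓘(ℝ, E) 𝓘(ℝ, ℝ) ∞ f) (hZ : IsSmoothField Z) :
    curvature D X Y (f • Z) = f • curvature D X Y Z := by
  have hXf := hX.contMDiff_directionalDeriv hf
  have hYf := hY.contMDiff_directionalDeriv hf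
  have hXZ := hD X Z hX hZ
  have hYZ := hD Y Z hY hZ
  rw [curvature, nabla_smul_right X hf hZ, nabla_smul_right Y hf hZ, nabla_smul_right _ hf hZ,
    nabla_add_right X (hYZ.smul hf) (hZ.smul hYf), nabla_add_right Y (hXZ.smul hf) (hZ.smul hXf),
    nabla_smul_right X hf hYZ, nabla_smul_right X hYf hZ,
    nabla_smul_right Y hf hXZ, nabla_smul_right Y hXf hZ,
    directionalDeriv_mlieBracket_smul hX hY hZ hf, curvature]
  module

lemma IsSmoothConnection.curvature_const_smul_right (hD : IsSmoothConnection D)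
    (hX : IsSmoothField X) (hY : IsSmoothField Y) (a : ℝ) (hZ : IsSmoothField Z) :
    curvature D X Y (a • Z) = a • curvature D X Y Z :=
  hD.curvature_smul_right hX hY (f := fun _ ↦ a) contMDiff_const hZ

lemma IsParallelField.curvature_eq_zero (hξ : IsParallelField D ξ) (hX : IsSmoothField X)
    (hY : IsSmoothField Y) : curvature D X Y ξ = 0 := by
  have nabla_zero (A : (x : M) → TangentSpace 𝓘(ℝ, E) x) : nabla D A 0 = 0 :=
    funext fun x ↦ by simp [nabla]
  simp [curvature, hξ X hX, hξ Y hY, hξ _ (hX.mlieBracket hY), nabla_zero]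

end Connection

section OneForm

/-- A `1`-form is smooth if its values on smooth vector fields are smooth functions. -/
def IsSmoothOneForm (η : (x : M) → TangentSpace 𝓘(ℝ, E) x →L[ℝ] ℝ) : Prop :=
  ∀ X : (x : M) → TangentSpace 𝓘(ℝ, E) x, IsSmoothField X →
    ContMDiff 𝓘(ℝ, E) 𝓘(ℝ, ℝ) ∞ (pairing η X)

lemma IsParallelOneForm.directionalDeriv_pairing (hη : IsParallelOneForm D η)
    (hX : IsSmoothField X) (hY : IsSmoothField Y) :
    directionalDeriv X (pairing η Y) = pairing η (nabla D X Y) :=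
  funext fun x ↦ sub_eq_zero.1 (hη X Y hX hY x)

lemma IsParallelOneForm.pairing_curvature_eq_zero [CompleteSpace E] (hη : IsParallelOneForm D η)
    (hη_smooth : IsSmoothOneForm η) (hD : IsSmoothConnection D) (hξ : IsSmoothField ξ)
    (hηξ : pairing η ξ = 1) (hX : IsSmoothField X) (hY : IsSmoothField Y) (hZ : IsSmoothField Z) :
    pairing η (curvature D X Y Z) = 0 := by
  have h := congrArg (pairing η) (directionalDeriv_mlieBracket_smul hX hY hξ (hη_smooth Z hZ))
  rw [pairing_smul, pairing_smul, hηξ, mul_one, mul_one,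
    hη.directionalDeriv_pairing (hX.mlieBracket hY) hZ, hη.directionalDeriv_pairing hX hZ,
    hη.directionalDeriv_pairing hY hZ, hη.directionalDeriv_pairing hX (hD Y Z hY hZ),
    hη.directionalDeriv_pairing hY (hD X Z hX hZ)] at h
  rw [curvature, pairing_sub, pairing_sub, h, sub_self]

end OneForm

section Deformation

/-- The connection `∇'_X Y = ∇_X Y + c η(Y) X + d η(X) Y`. It is the projective semi-symmetric
connection with `ψ = ((c + d) / 2) η` and `φ = ((c - d) / 2) η`. -/
noncomputable def oneFormDeformation
    (D : CovariantDerivative 𝓘(ℝ, E) E (TangentSpace 𝓘(ℝ, E) : M → Type _))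
    (η : (x : M) → TangentSpace 𝓘(ℝ, E) x →L[ℝ] ℝ) (c d : ℝ) :
    CovariantDerivative 𝓘(ℝ, E) E (TangentSpace 𝓘(ℝ, E) : M → Type _) :=
  D.addOneForm fun x ↦
    let α : E →L[ℝ] ℝ := η x
    c • α.smulRight (ContinuousLinearMap.id ℝ E) + d • ContinuousLinearMap.smulRightL ℝ E E α

lemma nabla_oneFormDeformation (X Y : (x : M) → TangentSpace 𝓘(ℝ, E) x) :
    nabla (oneFormDeformation D η c d) X Y =
      nabla D X Y + c • pairing η Y • X + d • pairing η X • Y := by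
  funext x
  exact (add_assoc _ _ _).symm

lemma projSemiSymmConnection_eq_oneFormDeformation
    (D : CovariantDerivative 𝓘(ℝ, E) E (TangentSpace 𝓘(ℝ, E) : M → Type _))
    (η : (x : M) → TangentSpace 𝓘(ℝ, E) x →L[ℝ] ℝ) :
    projSemiSymmConnection D η = oneFormDeformation D η
      ((Module.finrank ℝ E : ℝ) / ((Module.finrank ℝ E : ℝ) + 1))
      (-1 / ((Module.finrank ℝ E : ℝ) + 1)) := by
  have hn : (Module.finrank ℝ E : ℝ) + 1 ≠ 0 := by positivity
  refine CovariantDerivative.ext (funext fun Y ↦ funext fun x ↦ ContinuousLinearMap.ext fun v ↦ ?_)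
  let V : (y : M) → TangentSpace 𝓘(ℝ, E) y := fun _ ↦ (v : E)
  change nabla (projSemiSymmConnection D η) V Y x = nabla (oneFormDeformation D η _ _) V Y x
  rw [nabla_projSemiSymmConnection, nabla_oneFormDeformation]
  simp only [pairing, Pi.add_apply, Pi.smul_apply, Pi.smul_apply']
  match_scalars <;> field_simp <;> ring

lemma IsSmoothConnection.oneFormDeformation (hD : IsSmoothConnection D) (hη : IsSmoothOneForm η)
    (c d : ℝ) : IsSmoothConnection (oneFormDeformation D η c d) := by
  intro X Y hX hY
  rw [nabla_oneFormDeformation]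
  exact ((hD X Y hX hY).add ((hX.smul (hη Y hY)).const_smul c)).add
    ((hY.smul (hη X hX)).const_smul d)

lemma IsParallelOneForm.nabla_nabla_oneFormDeformation (hpar : IsParallelOneForm D η)
    (hη : IsSmoothOneForm η) (hD : IsSmoothConnection D)
    (hX : IsSmoothField X) (hY : IsSmoothField Y) (hZ : IsSmoothField Z) :
    nabla D X (nabla (oneFormDeformation D η c d) Y Z) = nabla D X (nabla D Y Z)
      + c • (pairing η Z • nabla D X Y + pairing η (nabla D X Z) • Y)
      + d • (pairing η Y • nabla D X Z + pairing η (nabla D X Y) • Z) := by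
  have hYZ := hD Y Z hY hZ
  have hηZY := hY.smul (hη Z hZ)
  have hηYZ := hZ.smul (hη Y hY)
  rw [nabla_oneFormDeformation,
    nabla_add_right X (hYZ.add (hηZY.const_smul c)) (hηYZ.const_smul d),
    nabla_add_right X hYZ (hηZY.const_smul c), nabla_const_smul_right X c hηZY,
    nabla_const_smul_right X d hηYZ, nabla_smul_right X (hη Z hZ) hY,
    nabla_smul_right X (hη Y hY) hZ, hpar.directionalDeriv_pairing hX hZ,
    hpar.directionalDeriv_pairing hX hY]

theorem IsParallelOneForm.curvature_oneFormDeformation (hpar : IsParallelOneForm D η)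
    (hη : IsSmoothOneForm η) (hD : IsSmoothConnection D) (htor : IsTorsionFree D)
    (hX : IsSmoothField X) (hY : IsSmoothField Y) (hZ : IsSmoothField Z) :
    curvature (oneFormDeformation D η c d) X Y Z = curvature D X Y Z
      + c ^ 2 • pairing η Z • (pairing η Y • X - pairing η X • Y) := by
  rw [curvature, nabla_oneFormDeformation X (nabla _ Y Z),
    nabla_oneFormDeformation Y (nabla _ X Z),
    nabla_oneFormDeformation (mlieBracket 𝓘(ℝ, E) X Y) Z,
    hpar.nabla_nabla_oneFormDeformation hη hD hX hY hZ,
    hpar.nabla_nabla_oneFormDeformation hη hD hY hX hZ, nabla_oneFormDeformation Y Z,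
    nabla_oneFormDeformation X Z, curvature, htor X Y hX hY]
  simp only [pairing_add, pairing_sub, pairing_smul, pairing_const_smul]
  funext x
  simp only [Pi.add_apply, Pi.sub_apply, Pi.mul_apply, Pi.smul_apply, Pi.smul_apply', smul_eq_mul]
  module

-- `∇' η = -(c + d) η ⊗ η`
lemma IsParallelOneForm.directionalDeriv_pairing_oneFormDeformation
    (hpar : IsParallelOneForm D η) (hX : IsSmoothField X) (hY : IsSmoothField Y) :
    directionalDeriv X (pairing η Y) =
      pairing η (nabla (oneFormDeformation D η c d) X Y)
        - (c + d) • (pairing η X * pairing η Y) := by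
  rw [hpar.directionalDeriv_pairing hX hY, nabla_oneFormDeformation]
  simp only [pairing_add, pairing_smul, pairing_const_smul]
  funext x
  simp only [Pi.add_apply, Pi.sub_apply, Pi.mul_apply, Pi.smul_apply, smul_eq_mul]
  ring

theorem IsFlat.isRecurrentWith_oneFormDeformation (hflat : IsFlat D)
    (hD : IsSmoothConnection D) (htor : IsTorsionFree D) (hη : IsSmoothOneForm η)
    (hpar : IsParallelOneForm D η) (c d : ℝ) :
    IsRecurrentWith (oneFormDeformation D η c d) (fun x ↦ (-(2 * (c + d))) • η x) := by
  have hD' := hD.oneFormDeformation hη c d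
  have curvature_eq {A B C : (x : M) → TangentSpace 𝓘(ℝ, E) x} (hA : IsSmoothField A)
      (hB : IsSmoothField B) (hC : IsSmoothField C) :
      curvature (oneFormDeformation D η c d) A B C
        = c ^ 2 • pairing η C • (pairing η B • A - pairing η A • B) := by
    rw [hpar.curvature_oneFormDeformation hη hD htor hA hB hC, hflat A B C hA hB hC, zero_add]
  intro X Y Z U hX hY hZ hU x
  have hηZY := hY.smul (hη Z hZ)
  have hηYZ := hZ.smul (hη Y hY)
  rw [nablaCurvature, curvature_eq hY hZ hU, curvature_eq (hD' X Y hX hY) hZ hU,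
    curvature_eq hY (hD' X Z hX hZ) hU, curvature_eq hY hZ (hD' X U hX hU),
    nabla_const_smul_right X _ ((hηZY.sub hηYZ).smul (hη U hU)),
    nabla_smul_right X (hη U hU) (hηZY.sub hηYZ), nabla_sub_right X hηZY hηYZ,
    nabla_smul_right X (hη Z hZ) hY, nabla_smul_right X (hη Y hY) hZ,
    hpar.directionalDeriv_pairing_oneFormDeformation (c := c) (d := d) hX hU,
    hpar.directionalDeriv_pairing_oneFormDeformation (c := c) (d := d) hX hZ,
    hpar.directionalDeriv_pairing_oneFormDeformation (c := c) (d := d) hX hY]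
  simp only [pairing, Pi.add_apply, Pi.sub_apply, Pi.mul_apply, Pi.smul_apply, Pi.smul_apply',
    smul_apply, smul_eq_mul]
  module

-- Evaluated at `(ξ, Z, X, Y, ξ)`, all terms of `R' · R'` but a multiple of `R(X, Y) Z` cancel:
-- `R'` takes values in `ker η`, and `R'(A, B) ξ = c² (η(B) A - η(A) B)`.
theorem curvatureActCurvature_oneFormDeformation_eq_smul_curvature [CompleteSpace E]
    (hD : IsSmoothConnection D) (htor : IsTorsionFree D) (hη : IsSmoothOneForm η)
    (hpar : IsParallelOneForm D η) (hξ : IsSmoothField ξ) (hξ_par : IsParallelField D ξ)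
    (hηξ : pairing η ξ = 1) (hX : IsSmoothField X) (hY : IsSmoothField Y) (hZ : IsSmoothField Z) :
    curvatureActCurvature (oneFormDeformation D η c d) ξ Z X Y ξ = c ^ 2 • curvature D X Y Z := by
  set D' := oneFormDeformation D η c d
  have hD' : IsSmoothConnection D' := hD.oneFormDeformation hη c d
  have curvature_eq {A B C : (x : M) → TangentSpace 𝓘(ℝ, E) x} (hA : IsSmoothField A)
      (hB : IsSmoothField B) (hC : IsSmoothField C) :
      curvature D' A B C
        = curvature D A B C + c ^ 2 • pairing η C • (pairing η B • A - pairing η A • B) :=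
    hpar.curvature_oneFormDeformation hη hD htor hA hB hC
  have curvature_ξ {A B : (x : M) → TangentSpace 𝓘(ℝ, E) x} (hA : IsSmoothField A)
      (hB : IsSmoothField B) :
      curvature D' A B ξ = c ^ 2 • (pairing η B • A - pairing η A • B) := by
    rw [curvature_eq hA hB hξ, hξ_par.curvature_eq_zero hA hB, hηξ, one_smul, zero_add]
  have pairing_curvature {A : (x : M) → TangentSpace 𝓘(ℝ, E) x} (hA : IsSmoothField A) :
      pairing η (curvature D' ξ Z A) = 0 := by
    rw [curvature_eq hξ hZ hA, pairing_add,
      hpar.pairing_curvature_eq_zero hη hD hξ hηξ hξ hZ hA]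
    simp only [pairing_const_smul, pairing_smul, pairing_sub, hηξ, mul_one, one_mul, sub_self,
      mul_zero, smul_zero, add_zero]
  have hηYX := hX.smul (hη Y hY)
  have hηXY := hY.smul (hη X hX)
  have hηZξ := hξ.smul (hη Z hZ)
  have first_term : curvature D' ξ Z (curvature D' X Y ξ)
      = c ^ 2 • (pairing η Y • curvature D' ξ Z X - pairing η X • curvature D' ξ Z Y) := by
    rw [curvature_ξ hX hY, hD'.curvature_const_smul_right hξ hZ _ (hηYX.sub hηXY),
      hD'.curvature_sub_right hξ hZ hηYX hηXY, hD'.curvature_smul_right hξ hZ (hη Y hY) hX,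
      hD'.curvature_smul_right hξ hZ (hη X hX) hY]
  have last_term : curvature D' X Y (curvature D' ξ Z ξ) = -c ^ 2 • curvature D X Y Z := by
    rw [curvature_ξ hξ hZ, hηξ, one_smul, hD'.curvature_const_smul_right hX hY _ (hηZξ.sub hZ),
      hD'.curvature_sub_right hX hY hηZξ hZ, hD'.curvature_smul_right hX hY (hη Z hZ) hξ,
      curvature_ξ hX hY, curvature_eq hX hY hZ]
    module
  rw [curvatureActCurvature, first_term, last_term,
    curvature_ξ (hD'.isSmoothField_curvature hξ hZ hX) hY,
    curvature_ξ hX (hD'.isSmoothField_curvature hξ hZ hY),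
    pairing_curvature hX, pairing_curvature hY]
  module

theorem IsSemiSymmetricFor.isFlat [CompleteSpace E]
    (hsemi : IsSemiSymmetricFor (oneFormDeformation D η c d)) (hc : c ≠ 0)
    (hD : IsSmoothConnection D) (htor : IsTorsionFree D) (hη : IsSmoothOneForm η)
    (hpar : IsParallelOneForm D η) (hξ : IsSmoothField ξ) (hξ_par : IsParallelField D ξ)
    (hηξ : pairing η ξ = 1) : IsFlat D := by
  intro X Y Z hX hY hZ
  have h := hsemi ξ Z X Y ξ hξ hZ hX hY hξ
  rw [curvatureActCurvature_oneFormDeformation_eq_smul_curvature hD htor hη hpar hξ hξ_par hηξ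
    hX hY hZ] at h
  exact (smul_eq_zero_iff_right (pow_ne_zero 2 hc)).1 h

end Deformation

section LeviCivita

variable {g : ContMDiffRiemannianMetric 𝓘(ℝ, E) ∞ E (TangentSpace 𝓘(ℝ, E) : M → Type _)}

lemma IsSmoothField.isSmoothOneForm_dualForm (hξ : IsSmoothField ξ) :
    IsSmoothOneForm (dualForm g ξ) := by
  intro X hX
  have h : ContMDiff 𝓘(ℝ, E) (𝓘(ℝ, E).prod 𝓘(ℝ)) ∞
      (fun x ↦ TotalSpace.mk' ℝ (E := Bundle.Trivial M ℝ) x (g.inner x (ξ x) (X x))) :=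
    ContMDiff.clm_bundle_apply₂ (F₁ := E) (F₂ := E) g.contMDiff hξ hX
  exact fun x ↦ (contMDiffAt_totalSpace.1 (h x)).2

variable [FiniteDimensional ℝ E]

lemma IsLeviCivita.isSmoothConnection (hD : IsLeviCivita g D) : IsSmoothConnection D := by
  intro X Y hX hY
  have h := hD.smooth.contMDiff.contMDiff (σ := Y) (ContMDiff.contMDiffOn (by simpa using! hY))
  exact ContMDiff.clm_bundle_apply (contMDiffOn_univ.1 h) hX

lemma IsLeviCivita.isTorsionFree (hD : IsLeviCivita g D) : IsTorsionFree D := by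
  have : CompleteSpace E := FiniteDimensional.complete ℝ E
  exact fun X Y hX hY ↦ funext fun x ↦ (D.torsion_eq_zero_iff.1 hD.torsion_free
    (hX.mdifferentiableAt x) (hY.mdifferentiableAt x)).symm

-- With `V = ∇_X ξ`, both `X(g(ξ, V)) = g(V, V) + g(ξ, ∇_X V)` and `X(η(V)) = η(∇_X V)`.
lemma IsLeviCivita.isParallelField_of_isParallelOneForm_dualForm (hD : IsLeviCivita g D)
    (hξ : IsSmoothField ξ) (hpar : IsParallelOneForm D (dualForm g ξ)) : IsParallelField D ξ := by
  intro X hX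
  have hV := hD.isSmoothConnection X ξ hX hξ
  funext x
  have inner_self : g.inner x (nabla D X ξ x) (nabla D X ξ x) = 0 := by
    have h := hpar X (nabla D X ξ) hX hV x
    have h' := hD.metric X ξ (nabla D X ξ) hX hξ hV x
    simp only [dualForm] at h
    linarith
  by_contra hne
  exact (g.pos x _ hne).ne' inner_self

end LeviCivita

end ProjSemiSymm

open ProjSemiSymm in
theorem corollary4p3_general
    {E : Type*} [NormedAddCommGroup E] [NormedSpace ℝ E] [CompleteSpace E]
    {M : Type*} [TopologicalSpace M] [ChartedSpace E M] [IsManifold 𝓘(ℝ, E) ∞ M]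
    {D : CovariantDerivative 𝓘(ℝ, E) E (TangentSpace 𝓘(ℝ, E) : M → Type _)}
    (hD : IsSmoothConnection D) (htor : IsTorsionFree D)
    {η : (x : M) → TangentSpace 𝓘(ℝ, E) x →L[ℝ] ℝ} (hη : IsSmoothOneForm η)
    (hpar : IsParallelOneForm D η)
    {ξ : (x : M) → TangentSpace 𝓘(ℝ, E) x} (hξ : IsSmoothField ξ)
    (hξ_par : IsParallelField D ξ) (hηξ : ∀ x, η x (ξ x) = 1)
    {c d : ℝ} (hc : c ≠ 0) (hsemi : IsSemiSymmetricFor (oneFormDeformation D η c d)) :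
    IsRecurrentWith (oneFormDeformation D η c d) (fun x ↦ (-(2 * (c + d))) • η x) :=
  (hsemi.isFlat hc hD htor hη hpar hξ hξ_par (funext hηξ)).isRecurrentWith_oneFormDeformation
    hD htor hη hpar c d

open ProjSemiSymm in
theorem corollary4p3
    {E : Type*} [NormedAddCommGroup E] [NormedSpace ℝ E] [FiniteDimensional ℝ E]
    {M : Type*} [TopologicalSpace M] [T2Space M] [ChartedSpace E M] [IsManifold 𝓘(ℝ, E) ∞ M]
    (g : ContMDiffRiemannianMetric 𝓘(ℝ, E) ∞ E (TangentSpace 𝓘(ℝ, E) : M → Type _))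
    (n : ℕ) (hdim : Module.finrank ℝ E = n) (hn : 2 < n)
    (D : CovariantDerivative 𝓘(ℝ, E) E (TangentSpace 𝓘(ℝ, E) : M → Type _))
    (hD : IsLeviCivita g D)
    (ξ : (x : M) → TangentSpace 𝓘(ℝ, E) x) (hξ : IsSmoothField ξ)
    (hunit : ∀ x : M, g.inner x (ξ x) (ξ x) = 1)
    (hparallel : IsParallelOneForm D (dualForm g ξ))
    (hsemi : IsSemiSymmetricFor (projSemiSymmConnection D (dualForm g ξ))) :
    IsRecurrentWith (projSemiSymmConnection D (dualForm g ξ))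
      (fun x => (-(2 * ((n : ℝ) - 1) / ((n : ℝ) + 1))) • dualForm g ξ x) := by
  have : CompleteSpace E := FiniteDimensional.complete ℝ E
  rw [projSemiSymmConnection_eq_oneFormDeformation, hdim] at hsemi ⊢
  convert corollary4p3_general hD.isSmoothConnection hD.isTorsionFree hξ.isSmoothOneForm_dualForm
    hparallel hξ (hD.isParallelField_of_isParallelOneForm_dualForm hξ hparallel) hunit
    (by positivity) hsemi using 3
  ring
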